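/- For $d\in\mathbb{N}$ and $\delta,\eta\in\mathbb{R}$, call a differentiable convex function $\Psi:\mathbb{R}^d_{\ge 0}\to\mathbb{R}_{\ge 0}$ a $(\delta,\eta)$-approximation of the norm $\|\cdot\|_\infty$ on $\mathbb{R}^d$ if 1. $\|x\|_\infty\le\Psi(x)\le\|x\|_\infty+\delta$ for all $x\in\mathbb{R}^d_{\ge 0}$, and 2. $\nabla\Psi(x+y)\le\exp(\eta\|y\|_\infty)\cdot\nabla\Psi(x)$ componentwise for all $x,y\in\mathbb{R}^d_{\ge 0}$. (At boundary points of $\mathbb{R}^d_{\ge 0}$, derivatives are taken relative to $\mathbb{R}^d_{\ge 0}$.) **Proposition.** There is no $(o(\log d),1)$-approximation of $\ell_\infty$. That is, for every function $\alpha:\mathbb{N}\to\mathbb{R}$ with $\alpha(d)=o(\log d)$ as $d\to\infty$ and for all sufficiently large $d$, there exists no $(\alpha(d),1)$-approximation of $\|\cdot\|_\infty$ on $\mathbb{R}^d$. -/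

import Mathlib

open Filter Asymptotics

namespace NormApx

/-- The nonnegative orthant of `ℝ^d`. -/
def orthant (d : ℕ) : Set (Fin d → ℝ) := {x | ∀ i, 0 ≤ x i}

/-- The gradient, at `x`, of a function on the nonnegative orthant: the vector of its partial
derivatives, where the derivative is taken within the orthant. (The orthant is convex with nonempty
interior, so that this derivative is unique also at boundary points.) -/
noncomputable def grad {d : ℕ} (Ψ : (Fin d → ℝ) → ℝ) (x : Fin d → ℝ) : Fin d → ℝ :=
  fun i => fderivWithin ℝ Ψ (orthant d) x (Pi.single i 1)

/-- The `ℓ_∞` norm on `ℝ^d` (the norm that Mathlib puts on `Fin d → ℝ`). -/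
noncomputable def linfty (d : ℕ) : (Fin d → ℝ) → ℝ := fun x => ‖x‖

/-- `Ψ` is a `(δ, η)`-approximation of the norm `N` on `ℝ^d`. Only the values of `Ψ` on the
nonnegative orthant matter. -/
structure IsNormApproximation {d : ℕ} (N : (Fin d → ℝ) → ℝ) (δ η : ℝ)
    (Ψ : (Fin d → ℝ) → ℝ) : Prop where
  nonneg : ∀ x ∈ orthant d, 0 ≤ Ψ x
  differentiable : DifferentiableOn ℝ Ψ (orthant d)
  convex : ConvexOn ℝ (orthant d) Ψ
  lower : ∀ x ∈ orthant d, N x ≤ Ψ x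
  upper : ∀ x ∈ orthant d, Ψ x ≤ N x + δ
  bounded_increase : ∀ x ∈ orthant d, ∀ y ∈ orthant d, ∀ i,
    grad Ψ (x + y) i ≤ Real.exp (η * linfty d y) * grad Ψ x i

end NormApx

namespace NormApx

/-! Convexity and linear growth along the diagonal force the partials at 0 to sum to at most 1, so
some coordinate `i` has partial at most `1/d`. Bounded increase caps the derivative at `t e_i` by
`e^t / d`, so `Ψ` gains less than 1 up to `t = log d`. There `Ψ ≥ log d`, while `Ψ 0 ≤ δ`; hence
`log d ≤ δ + 1`. -/

/-- The derivative of `Ψ` along the ray spanned by a nonnegative vector. -/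
theorem hasDerivWithinAt_ray {d : ℕ} {Ψ : (Fin d → ℝ) → ℝ}
    (hΨ : DifferentiableOn ℝ Ψ (orthant d)) {v : Fin d → ℝ} (hv : v ∈ orthant d)
    {t : ℝ} (ht : 0 ≤ t) :
    HasDerivWithinAt (fun s : ℝ => Ψ (s • v)) (fderivWithin ℝ Ψ (orthant d) (t • v) v)
      (Set.Ici 0) t := by
  have hmaps : Set.MapsTo (fun s : ℝ => s • v) (Set.Ici 0) (orthant d) :=
    fun s hs i => mul_nonneg hs (hv i)
  have hlin : HasDerivWithinAt (fun s : ℝ => s • v) v (Set.Ici 0) t := by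
    simpa using ((hasDerivAt_id t).smul_const v).hasDerivWithinAt (s := Set.Ici 0)
  exact (hΨ _ (hmaps ht)).hasFDerivWithinAt.comp_hasDerivWithinAt t hlin hmaps

/-- The partial derivatives at the origin of an approximation of `ℓ_∞` sum to at most `1`. -/
theorem IsNormApproximation.sum_grad_zero_le {d : ℕ} {δ η : ℝ} {Ψ : (Fin d → ℝ) → ℝ}
    (h : IsNormApproximation (linfty d) δ η Ψ) : ∑ i, grad Ψ 0 i ≤ 1 := by
  have hone : (1 : Fin d → ℝ) ∈ orthant d := fun i => zero_le_one
  have hsum : ∑ i, grad Ψ 0 i = fderivWithin ℝ Ψ (orthant d) 0 1 := by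
    simp only [grad]
    rw [← map_sum]
    exact congrArg _ (Finset.univ_sum_single (1 : Fin d → ℝ))
  have hconv : ConvexOn ℝ (Set.Ici 0) (fun s : ℝ => Ψ (s • (1 : Fin d → ℝ))) := by
    refine (h.convex.comp_linearMap (LinearMap.toSpanSingleton ℝ _ (1 : Fin d → ℝ))).subset
      (fun s hs i => mul_nonneg hs (hone i)) (convex_Ici 0)
  have hder := hasDerivWithinAt_ray h.differentiable hone le_rfl
  rw [zero_smul, ← hsum] at hder
  set σ := ∑ i, grad Ψ 0 i
  -- The slope at 0 is at most the secant slope, and `Ψ 0 ≥ 0`.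
  have hbound : ∀ t : ℝ, 0 < t → σ * t ≤ t + δ := by
    intro t ht
    have hmem : t • (1 : Fin d → ℝ) ∈ orthant d := fun i => mul_nonneg ht.le (hone i)
    have hslope := hconv.le_slope_of_hasDerivWithinAt_Ioi Set.self_mem_Ici ht.le ht
      (hder.mono Set.Ioi_subset_Ici_self)
    rw [slope_def_field, sub_zero, le_div_iff₀ ht] at hslope
    have hnorm : linfty d (t • (1 : Fin d → ℝ)) ≤ t :=
      (pi_norm_le_iff_of_nonneg ht.le).2 fun i => by simp [abs_of_pos ht]
    have h0 := h.nonneg 0 fun i => le_rfl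
    have hup := h.upper _ hmem
    simp only [zero_smul] at hslope
    linarith
  by_contra! hσ
  have hpos : 0 < σ - 1 := sub_pos.2 hσ
  -- This `t` makes `(σ - 1) * t` exceed `δ`; `|δ|` keeps it positive.
  have hlarge := hbound ((|δ| + 1) / (σ - 1)) (by positivity)
  have hmul : (σ - 1) * ((|δ| + 1) / (σ - 1)) = |δ| + 1 := mul_div_cancel₀ _ hpos.ne'
  linarith [le_abs_self δ]

/-- A `(δ, 1)`-approximation of `ℓ_∞` has `log d - 1 ≤ δ`. -/
theorem IsNormApproximation.log_sub_one_le {d : ℕ} (hd : 0 < d) {δ : ℝ} {Ψ : (Fin d → ℝ) → ℝ}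
    (h : IsNormApproximation (linfty d) δ 1 Ψ) : Real.log d - 1 ≤ δ := by
  have hd' : (0 : ℝ) < d := Nat.cast_pos.2 hd
  have : Nonempty (Fin d) := ⟨⟨0, hd⟩⟩
  obtain ⟨i, -, hi⟩ : ∃ i ∈ Finset.univ, grad Ψ 0 i ≤ (d : ℝ)⁻¹ := by
    refine Finset.exists_le_of_sum_le Finset.univ_nonempty ?_
    simpa [hd'.ne'] using h.sum_grad_zero_le
  have hL : 0 ≤ Real.log d := Real.log_natCast_nonneg d
  have hv : (Pi.single i 1 : Fin d → ℝ) ∈ orthant d := fun j => by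
    by_cases hj : j = i
    · subst hj; simp
    · simp [hj]
  have hray : ∀ t : ℝ, 0 ≤ t → t • (Pi.single i 1 : Fin d → ℝ) ∈ orthant d :=
    fun t ht j => mul_nonneg ht (hv j)
  have hnorm : ∀ t : ℝ, 0 ≤ t → linfty d (t • (Pi.single i 1 : Fin d → ℝ)) = t := fun t ht => by
    simp [linfty, norm_smul, abs_of_nonneg ht, Pi.norm_single]
  -- Integrates the bound `e^t / d` by comparing derivatives, so `grad Ψ` need not be integrable.
  have hle := image_le_of_deriv_right_le_deriv_boundary
    (f := fun t : ℝ => Ψ (t • (Pi.single i 1 : Fin d → ℝ)))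
    (f' := fun t => grad Ψ (t • (Pi.single i 1 : Fin d → ℝ)) i)
    (B := fun t => Ψ 0 + (Real.exp t - 1) * (d : ℝ)⁻¹)
    (B' := fun t => Real.exp t * (d : ℝ)⁻¹) (a := 0) (b := Real.log d)
    (fun t ht => ((hasDerivWithinAt_ray h.differentiable hv ht.1).mono
      Set.Icc_subset_Ici_self).continuousWithinAt)
    (fun t ht => (hasDerivWithinAt_ray h.differentiable hv ht.1).mono
      (Set.Ici_subset_Ici.2 ht.1))
    (by simp) (by fun_prop)
    (fun t _ => ((((Real.hasDerivAt_exp t).sub_const 1).mul_const _).const_add _).hasDerivWithinAt)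
    (fun t ht => by
      have hg := h.bounded_increase 0 (fun _ => le_rfl) _ (hray t ht.1) i
      rw [zero_add, one_mul, hnorm t ht.1] at hg
      exact hg.trans (by gcongr))
    ⟨hL, le_rfl⟩
  have hlow := h.lower _ (hray _ hL)
  have hup := h.upper 0 fun _ => le_rfl
  have hexp : (Real.exp (Real.log d) - 1) * (d : ℝ)⁻¹ ≤ 1 := by
    rw [Real.exp_log hd', sub_mul, mul_inv_cancel₀ hd'.ne']
    have := inv_pos.2 hd'
    linarith
  rw [hnorm _ hL] at hlow
  have hzero : linfty d 0 = 0 := norm_zero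
  linarith

end NormApx

theorem mainTheorem11 (α : ℕ → ℝ)
    (hα : α =o[atTop] (fun d : ℕ => Real.log (d : ℝ))) :
    ∀ᶠ d : ℕ in atTop,
      ¬ ∃ Ψ : (Fin d → ℝ) → ℝ,
        NormApx.IsNormApproximation (NormApx.linfty d) (α d) 1 Ψ := by
  have hlog : Tendsto (fun d : ℕ => Real.log (d : ℝ)) atTop atTop :=
    Real.tendsto_log_atTop.comp tendsto_natCast_atTop_atTop
  -- `log d - 1 ≤ α d ≤ (log d) / 2` would force `log d ≤ 2`.
  filter_upwards [hα.bound (c := 1 / 2) (by norm_num), hlog.eventually_gt_atTop 2,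
    eventually_gt_atTop 0] with d hαd hd hpos
  rintro ⟨Ψ, h⟩
  have hδ := h.log_sub_one_le hpos
  rw [Real.norm_eq_abs, Real.norm_of_nonneg (by linarith)] at hαd
  linarith [le_abs_self (α d)]
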